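/- All graphs are finite and simple. For a graph $G$ and $S\subseteq V(G)$ let $N(S)=\bigcup_{v\in S}N(v)$ be the set of all neighbors of vertices of $S$. A neighborhood total dominating set of $G$ is a set $S\subseteq V(G)$ such that every vertex outside $S$ is adjacent to a vertex of $S$ and the subgraph of $G$ induced by $N(S)$ has no isolated vertex; the neighborhood total domination number $\gamma_{\rm nt}(G)$ is the minimum cardinality of such a set. A leaf is a vertex of degree one, and a $2$-packing is a set of vertices that are pairwise at distance at least $3$. Let $\mathcal T$ be the family of all trees $T$ that can be obtained (up to isomorphism) as follows. Start with an arbitrary tree $T_0$. Form a tree $T_1$ from $T_0$ by doing, for each vertex $x\in V(T_0)$, one of the following: either add a new vertex and an edge joining it to $x$, or add a new path $P_3$ and an edge joining its central vertex to $x$. Then choose a (possibly empty) set $L_1$ of leaves of $T_1$ that is a $2$-packing in $T_1$, and for each $v\in L_1$ add some number $k=k(v)\ge 0$ of vertex-disjoint copies of $P_2$ and join $v$ to exactly one end of each added copy. Theorem. Let $T$ be a tree of order $n\ge 4$. If $\gamma_{\rm nt}(T)=n/2$, then $T\in\mathcal T$. -/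

import Mathlib

universe u

namespace NTD

variable {V : Type u}

/-- `S` is a dominating set of `G`. -/
def IsDominatingSet (G : SimpleGraph V) (S : Set V) : Prop :=
  ∀ v, v ∉ S → ∃ u ∈ S, G.Adj v u

/-- The open neighborhood `N(S)`: all neighbors of vertices of `S`. -/
def openNbhd (G : SimpleGraph V) (S : Set V) : Set V :=
  ⋃ v ∈ S, G.neighborSet v

/-- Neighborhood total dominating set (NTD-set): a dominating set `S` such that the subgraph
induced by the open neighborhood `N(S)` has no isolated vertex. -/
def IsNTDSet (G : SimpleGraph V) (S : Set V) : Prop :=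
  IsDominatingSet G S ∧ ∀ v, ¬ (G.induce (openNbhd G S)).IsIsolated v

/-- The whole vertex set is always an NTD-set, so the minimum defining the neighborhood total
domination number of a finite graph is over a nonempty set. -/
theorem isNTDSet_univ (G : SimpleGraph V) : IsNTDSet G Set.univ := by
  refine ⟨fun v hv => absurd (Set.mem_univ v) hv, ?_⟩
  rintro ⟨v, hv⟩ hiso
  obtain ⟨u, -, hu⟩ := Set.mem_iUnion₂.1 hv
  exact hiso ⟨u, Set.mem_iUnion₂.2 ⟨v, Set.mem_univ v, G.adj_symm hu⟩⟩ (G.adj_symm hu)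

/-- The neighborhood total domination number: the minimum cardinality of an NTD-set. -/
noncomputable def ntdNumber [Fintype V] (G : SimpleGraph V) : ℕ :=
  sInf {k : ℕ | ∃ S : Finset V, IsNTDSet G (S : Set V) ∧ S.card = k}

/-- A leaf is a vertex of degree one. -/
def IsLeaf (G : SimpleGraph V) (v : V) : Prop :=
  (G.neighborSet v).ncard = 1

/-- A 2-packing: a set of vertices that are pairwise at distance at least 3. -/
def IsTwoPacking (G : SimpleGraph V) (L : Set V) : Prop :=
  L.Pairwise fun u v => 3 ≤ G.edist u v

/-- Vertices of the base tree built from a tree on `V`; `S` is the set of vertices that receive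
a `P₃` (the other vertices receive a single new vertex). -/
inductive BaseVertex (S : Set V) : Type u
  /-- a vertex of the underlying tree -/
  | under (x : V) : BaseVertex S
  /-- the new vertex joined to `x`: the pendant vertex if `x ∉ S`, the centre of the new `P₃`
  if `x ∈ S` -/
  | attached (x : V) : BaseVertex S
  /-- the two ends of the new `P₃` at `x ∈ S` -/
  | tip (x : V) (hx : x ∈ S) (b : Bool) : BaseVertex S

/-- Edges (each in one orientation) of the base tree. -/
inductive BaseRel (T₀ : SimpleGraph V) (S : Set V) : BaseVertex S → BaseVertex S → Prop
  | under {x y : V} (h : T₀.Adj x y) : BaseRel T₀ S (.under x) (.under y)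
  | attached (x : V) : BaseRel T₀ S (.under x) (.attached x)
  | tip (x : V) (hx : x ∈ S) (b : Bool) : BaseRel T₀ S (.attached x) (.tip x hx b)

/-- The base tree `T₁`: each `x ∉ S` gets a new vertex joined to it, each `x ∈ S` gets a new path
`P₃` whose central vertex is joined to it. -/
def baseTree (T₀ : SimpleGraph V) (S : Set V) : SimpleGraph (BaseVertex S) :=
  SimpleGraph.fromRel (BaseRel T₀ S)

/-- Vertices of the graph obtained by appending `k v` copies of `P₂` to each `v ∈ L`. -/
inductive AppendVertex (L : Set V) (k : V → ℕ) : Type u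
  /-- a vertex of the original graph -/
  | old (v : V) : AppendVertex L k
  /-- the end joined to `v` of the `i`-th `P₂` appended to `v ∈ L` -/
  | near (v : V) (hv : v ∈ L) (i : Fin (k v)) : AppendVertex L k
  /-- the other end of the `i`-th `P₂` appended to `v ∈ L` -/
  | far (v : V) (hv : v ∈ L) (i : Fin (k v)) : AppendVertex L k

/-- Edges (each in one orientation) of the graph with appended `P₂`s. -/
inductive AppendRel (T₁ : SimpleGraph V) (L : Set V) (k : V → ℕ) :
    AppendVertex L k → AppendVertex L k → Prop
  | old {v w : V} (h : T₁.Adj v w) : AppendRel T₁ L k (.old v) (.old w)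
  | near (v : V) (hv : v ∈ L) (i : Fin (k v)) : AppendRel T₁ L k (.old v) (.near v hv i)
  | far (v : V) (hv : v ∈ L) (i : Fin (k v)) : AppendRel T₁ L k (.near v hv i) (.far v hv i)

/-- `T₁` with `k v ≥ 0` vertex-disjoint copies of `P₂` added for each `v ∈ L`, with `v` joined to
exactly one end of each copy. -/
def appendP2 (T₁ : SimpleGraph V) (L : Set V) (k : V → ℕ) : SimpleGraph (AppendVertex L k) :=
  SimpleGraph.fromRel (AppendRel T₁ L k)

/-- The family `𝒯`: the trees isomorphic to one obtained from an arbitrary finite tree `T₀` by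
forming a base tree `T₁`, choosing a set `L₁` of leaves of `T₁` that is a 2-packing in `T₁`, and
appending any number of `P₂`s to each vertex of `L₁`. -/
def InFamily (T : SimpleGraph V) : Prop :=
  ∃ (V₀ : Type u) (_ : Finite V₀) (T₀ : SimpleGraph V₀) (S : Set V₀)
    (L₁ : Set (BaseVertex S)) (k : BaseVertex S → ℕ),
    T₀.IsTree ∧
    (∀ v ∈ L₁, IsLeaf (baseTree T₀ S) v) ∧
    IsTwoPacking (baseTree T₀ S) L₁ ∧
    Nonempty (T ≃g appendP2 (baseTree T₀ S) L₁ k)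

end NTD

/-! A tree is assembled from single vertices by repeatedly joining two rooted pieces by an edge
between their roots. For each piece two kinds of evidence are recorded: partial NTD-sets `S`, with
the state of the root and an upper bound on the excess `2|S| - |s|`, and partial labellings of the
vertices by their roles in a tree of the family. Excesses add under joining, and the roots' states
and labels alone decide whether two pieces fit together.

Keeping only part of this evidence, every piece falls into one of finitely many classes, a list
closed under joining (`branchClasses_closed`, `Branch.exists_class`). By `branchClasses_final` each
class has a complete set of negative excess, a complete labelling, or odd order. If the domination
number is half the order, the first and third outcomes are impossible, so the tree has a complete
labelling.

A complete labelling is a local description of membership in the family. Slots pair each vertex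
outside `T₀` with a parent; base vertices induce `T₀`, and parent edges give the pendant vertices,
the `P₃`s and the appended `P₂`s. Base and claw vertices have only one slot for a centre, which
makes the centres a 2-packing. Rebuilding the tree from these data (`rebuiltIso`) and checking that
`T₀` is a tree finishes the proof. -/

namespace NTD

/-! ### Decomposition of a tree into rooted branches -/

section Branch

variable {V : Type u} [DecidableEq V] {G : SimpleGraph V}

/-- `Branch G s r`: the vertex set `s` is assembled from single vertices by repeatedly joining
two disjoint rooted pieces by an edge between their roots (the only edge of `G` between them);
`r` is the root of the result. -/
inductive Branch (G : SimpleGraph V) : Finset V → V → Prop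
  | single (v : V) : Branch G {v} v
  | join {s t : Finset V} {r c : V} (hs : Branch G s r) (ht : Branch G t c)
      (hd : Disjoint s t) (hadj : G.Adj r c)
      (huniq : ∀ x ∈ s, ∀ y ∈ t, G.Adj x y → x = r ∧ y = c) : Branch G (s ∪ t) r

theorem Branch.root_mem {s : Finset V} {r : V} (h : Branch G s r) : r ∈ s := by
  induction h with
  | single v => simp
  | join _ _ _ _ _ ih _ => exact Finset.mem_union_left _ ih

/-- Adjacency inside `s`. -/
def AdjIn (G : SimpleGraph V) (s : Finset V) (a b : V) : Prop :=
  G.Adj a b ∧ a ∈ s ∧ b ∈ s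

/-- The edge `rv` is a bridge, whereas an edge `ry` followed by the walk from `y` to `v` avoiding
`r` would bypass it. -/
theorem not_adj_of_isAcyclic_of_avoiding (hG : G.IsAcyclic) {s : Finset V} {r v y : V}
    (hrv : G.Adj r v) (hvy : Relation.ReflTransGen (AdjIn G (s.erase r)) v y) (hne : y ≠ v) :
    ¬ G.Adj r y := by
  intro hry
  have hb := SimpleGraph.isBridge_iff.1 (SimpleGraph.isAcyclic_iff_forall_adj_isBridge.1 hG hrv)
  apply hb
  have key : ∀ z, Relation.ReflTransGen (AdjIn G (s.erase r)) v z →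
      (G \ SimpleGraph.fromEdgeSet {s(r, v)}).Reachable v z := by
    intro z hz
    induction hz with
    | refl => exact SimpleGraph.Reachable.refl _
    | @tail b c _ hbc ih =>
      refine ih.trans (SimpleGraph.Adj.reachable ?_)
      have hb' : b ≠ r := Finset.ne_of_mem_erase hbc.2.1
      have hc' : c ≠ r := Finset.ne_of_mem_erase hbc.2.2
      simp only [SimpleGraph.sdiff_adj, SimpleGraph.fromEdgeSet_adj, Set.mem_singleton_iff,
        Sym2.eq_iff]
      exact ⟨hbc.1, by tauto⟩
  have h1 : (G \ SimpleGraph.fromEdgeSet {s(r, v)}).Adj r y := by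
    simp only [SimpleGraph.sdiff_adj, SimpleGraph.fromEdgeSet_adj, Set.mem_singleton_iff,
        Sym2.eq_iff]
    refine ⟨hry, ?_⟩
    rintro ⟨⟨-, h⟩ | ⟨h, h'⟩, -⟩
    · exact hne h
    · exact hry.ne h'.symm
  exact h1.reachable.trans (key y hvy).symm

/-- Split off the component `t` of a neighbour `v` of `r` after deleting `r`. Both `t` and `s \ t`
are smaller and connected to their roots, and acyclicity makes `rv` the only edge between them. -/
theorem branch_of_connected (hG : G.IsAcyclic) (n : ℕ) : ∀ (s : Finset V) (r : V),
    s.card ≤ n → r ∈ s → (∀ x ∈ s, Relation.ReflTransGen (AdjIn G s) r x) → Branch G s r := by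
  classical
  induction n with
  | zero =>
    intro s r hc hr
    rw [Finset.card_eq_zero.1 (Nat.le_zero.1 hc)] at hr
    simp at hr
  | succ n ih =>
    intro s r hc hr hconn
    by_cases hv : ∃ v ∈ s, G.Adj r v
    · obtain ⟨v, hvs, hrv⟩ := hv
      have hve : v ∈ s.erase r := Finset.mem_erase.2 ⟨hrv.ne', hvs⟩
      set t := s.filter (fun x => Relation.ReflTransGen (AdjIn G (s.erase r)) v x) with ht
      have mem_t : ∀ x, x ∈ t ↔ Relation.ReflTransGen (AdjIn G (s.erase r)) v x := by
        intro x
        rw [ht, Finset.mem_filter, and_iff_right_iff_imp]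
        intro h
        rcases h.cases_tail with h | ⟨_, -, h⟩
        · rwa [h]
        · exact Finset.mem_of_mem_erase h.2.2
      have hvt : v ∈ t := (mem_t v).2 .refl
      have hrt : r ∉ t := by
        intro h
        rcases ((mem_t r).1 h).cases_tail with h | ⟨_, -, h⟩
        · exact hrv.ne h
        · exact Finset.notMem_erase _ _ h.2.2
      have step : ∀ a ∈ t, ∀ b ∈ s, G.Adj a b → b ≠ r → b ∈ t := by
        intro a ha b hb hab hbr
        refine (mem_t b).2 (((mem_t a).1 ha).tail ⟨hab, ?_, Finset.mem_erase.2 ⟨hbr, hb⟩⟩)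
        exact Finset.mem_erase.2 ⟨fun h => hrt (h ▸ ha), Finset.filter_subset _ _ ha⟩
      have hts : t ⊆ s := Finset.filter_subset _ _
      have hrs : r ∈ s \ t := Finset.mem_sdiff.2 ⟨hr, hrt⟩
      have c1 : t.card < s.card := Finset.card_lt_card ⟨hts, fun h => hrt (h hr)⟩
      have c2 : (s \ t).card < s.card := Finset.card_lt_card
        ⟨Finset.sdiff_subset, fun h => (Finset.mem_sdiff.1 (h hvs)).2 hvt⟩
      have b1 : Branch G t v := by
        refine ih t v (by omega) hvt fun x hx => ?_
        have := (mem_t x).1 hx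
        clear hx
        induction this with
        | refl => exact .refl
        | @tail b c h1 h2 ih' => exact ih'.tail ⟨h2.1, (mem_t b).2 h1, (mem_t c).2 (h1.tail h2)⟩
      have b2 : Branch G (s \ t) r := by
        refine ih _ r (by omega) hrs ?_
        -- A walk can leave `t` only through `r`, so after a detour into `t` it is restarted at `r`.
        have key : ∀ x, Relation.ReflTransGen (AdjIn G s) r x →
            x ∈ t ∨ Relation.ReflTransGen (AdjIn G (s \ t)) r x := by
          intro x hx
          induction hx with
          | refl => exact .inr .refl
          | @tail a b _ hab ih' =>
            by_cases hb : b ∈ t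
            · exact .inl hb
            right
            by_cases hbr : b = r
            · rw [hbr]
            by_cases ha : a ∈ t
            · exact absurd (step a ha b hab.2.2 hab.1 hbr) hb
            · exact (ih'.resolve_left ha).tail ⟨hab.1, Finset.mem_sdiff.2 ⟨hab.2.1, ha⟩,
                Finset.mem_sdiff.2 ⟨hab.2.2, hb⟩⟩
        intro x hx
        have hx' := Finset.mem_sdiff.1 hx
        exact (key x (hconn x hx'.1)).resolve_left hx'.2
      have := b2.join b1 Finset.sdiff_disjoint hrv (by
        intro x hx y hy hxy
        have hx' := Finset.mem_sdiff.1 hx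
        have hxr : x = r := by
          by_contra hne
          exact hx'.2 (step y hy x hx'.1 hxy.symm hne)
        refine ⟨hxr, ?_⟩
        by_contra hne
        exact not_adj_of_isAcyclic_of_avoiding hG hrv ((mem_t y).1 hy) hne (hxr ▸ hxy))
      rwa [Finset.sdiff_union_of_subset hts] at this
    · have : s = {r} := by
        refine Finset.eq_singleton_iff_unique_mem.2 ⟨hr, fun x hx => ?_⟩
        rcases (hconn x hx).cases_head with h | ⟨y, h, -⟩
        · exact h.symm
        · exact absurd ⟨y, h.2.2, h.1⟩ hv
      rw [this]
      exact .single r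

theorem _root_.SimpleGraph.IsTree.branch_univ [Fintype V] (hG : G.IsTree) (r : V) :
    Branch G Finset.univ r := by
  refine branch_of_connected hG.isAcyclic _ _ r le_rfl (Finset.mem_univ r) ?_
  rintro x -
  obtain ⟨w⟩ := hG.connected.preconnected r x
  induction w with
  | nil => exact .refl
  | cons h _ ih => exact .head ⟨h, Finset.mem_univ _, Finset.mem_univ _⟩ ih

end Branch

/-! ### Partial NTD-sets and their states at the root -/

section DominationStates

variable {V : Type u} {G : SimpleGraph V}

/-- `v ∈ N(S)`. -/
def HasNbrIn (G : SimpleGraph V) (S : Finset V) (v : V) : Prop :=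
  ∃ u ∈ S, G.Adj v u

theorem HasNbrIn.mono {S S' : Finset V} {v : V} (hS : S ⊆ S') (h : HasNbrIn G S v) :
    HasNbrIn G S' v :=
  h.imp fun _ hu => ⟨hS hu.1, hu.2⟩

/-- Information about a partial NTD-set at the root `r` of a branch: whether `r ∈ S`, whether
`r ∈ N(S)`, whether `r` has a neighbour in `N(S)`, and whether other vertices rely on the promise
that `r` will eventually be in `N(S)`. -/
abbrev DomState := Bool × Bool × Bool × Bool

/-- `S` is a partial NTD-set of the branch `s` with root `r`, in state `σ`. -/
structure IsPartialNTD (G : SimpleGraph V) (s : Finset V) (r : V) (σ : DomState)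
    (S : Finset V) : Prop where
  mem_root : σ.1 = true → r ∈ S
  root_dom : σ.2.1 = true → HasNbrIn G S r
  root_near : σ.2.2.1 = true → ∃ u, G.Adj r u ∧ HasNbrIn G S u
  dom : ∀ v ∈ s, v ≠ r → v ∈ S ∨ HasNbrIn G S v
  near : ∀ v ∈ s, v ≠ r → v ∈ S ∨ ∃ u, G.Adj v u ∧ (HasNbrIn G S u ∨ u = r ∧ σ.2.2.2 = true)

/-- States `σ` of the parent branch and `τ` of the child branch can be combined to `ρ`. -/
abbrev JoinsTo (σ τ ρ : DomState) : Prop :=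
  (ρ.1 → σ.1) ∧ (ρ.2.1 → σ.2.1 || τ.1) ∧ (ρ.2.2.1 → σ.2.2.1 || (τ.2.1 || σ.1)) ∧
  (σ.2.2.2 → ρ.2.2.2) ∧ (τ.1 || (τ.2.1 || σ.1)) ∧ (τ.2.2.2 → τ.2.1 || σ.1) ∧
  (τ.1 || (τ.2.2.1 || ρ.2.2.2))

/-- Enlarging the set preserves all that was achieved, and new information passes along `rc`. The
first four conditions of `JoinsTo` track `r`; the last three settle `c`, which stops being a root:
it must be dominated or chosen, any promise about it must be kept, and, unless chosen, it needs a
neighbour in `N(S)` or a promise about `r`. -/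
theorem IsPartialNTD.join [DecidableEq V] {s t : Finset V} {r c : V} {σ τ ρ : DomState}
    {S S' : Finset V} (h : IsPartialNTD G s r σ S) (h' : IsPartialNTD G t c τ S')
    (hadj : G.Adj r c) (hj : JoinsTo σ τ ρ) : IsPartialNTD G (s ∪ t) r ρ (S ∪ S') := by
  obtain ⟨j1, j2, j3, j4, j5, j6, j7⟩ := hj
  have hS : S ⊆ S ∪ S' := Finset.subset_union_left
  have hS' : S' ⊆ S ∪ S' := Finset.subset_union_right
  have hc : τ.2.1 || σ.1 → HasNbrIn G (S ∪ S') c := by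
    intro hb
    rcases Bool.or_eq_true_iff.1 hb with hb | hb
    · exact (h'.root_dom hb).mono hS'
    · exact ⟨r, hS (h.mem_root hb), hadj.symm⟩
  refine ⟨fun hb => hS (h.mem_root (j1 hb)), fun hb => ?_, fun hb => ?_, fun v hv hvr => ?_,
    fun v hv hvr => ?_⟩
  · rcases Bool.or_eq_true_iff.1 (j2 hb) with hb | hb
    · exact (h.root_dom hb).mono hS
    · exact ⟨c, hS' (h'.mem_root hb), hadj⟩
  · rcases Bool.or_eq_true_iff.1 (j3 hb) with hb | hb
    · obtain ⟨u, hu, hu'⟩ := h.root_near hb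
      exact ⟨u, hu, hu'.mono hS⟩
    · exact ⟨c, hadj, hc hb⟩
  · rcases Finset.mem_union.1 hv with hv | hv
    · exact (h.dom v hv hvr).imp (@hS v) fun h => h.mono hS
    · by_cases hvc : v = c
      · subst hvc
        rcases Bool.or_eq_true_iff.1 j5 with hb | hb
        · exact .inl (hS' (h'.mem_root hb))
        · exact .inr (hc hb)
      · exact (h'.dom v hv hvc).imp (@hS' v) fun h => h.mono hS'
  · rcases Finset.mem_union.1 hv with hv | hv
    · refine (h.near v hv hvr).imp (@hS v) ?_
      rintro ⟨u, hu, hu'⟩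
      exact ⟨u, hu, hu'.imp (fun h => h.mono hS) fun h => ⟨h.1, j4 h.2⟩⟩
    · by_cases hvc : v = c
      · subst hvc
        rcases Bool.or_eq_true_iff.1 j7 with hb | hb
        · exact .inl (hS' (h'.mem_root hb))
        rcases Bool.or_eq_true_iff.1 hb with hb | hb
        · obtain ⟨u, hu, hu'⟩ := h'.root_near hb
          exact .inr ⟨u, hu, .inl (hu'.mono hS')⟩
        · exact .inr ⟨r, hadj.symm, .inr ⟨rfl, hb⟩⟩
      · refine (h'.near v hv hvc).imp (@hS' v) ?_
        rintro ⟨u, hu, hu' | ⟨rfl, hb⟩⟩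
        · exact ⟨u, hu, .inl (hu'.mono hS')⟩
        · exact ⟨u, hu, .inl (hc (j6 hb))⟩

/-- The branch `s` has a partial NTD-set in state `σ` with `2|S| ≤ |s| + w`. -/
def Attains (G : SimpleGraph V) (s : Finset V) (r : V) (σ : DomState) (w : ℤ) : Prop :=
  ∃ S : Finset V, IsPartialNTD G s r σ S ∧ 2 * (S.card : ℤ) ≤ s.card + w

theorem Attains.join [DecidableEq V] {s t : Finset V} {r c : V} {σ τ ρ : DomState} {w w' w'' : ℤ}
    (h : Attains G s r σ w) (h' : Attains G t c τ w') (hd : Disjoint s t) (hadj : G.Adj r c)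
    (hj : JoinsTo σ τ ρ) (hw : w + w' ≤ w'') : Attains G (s ∪ t) r ρ w'' := by
  obtain ⟨S, hS, hc⟩ := h
  obtain ⟨S', hS', hc'⟩ := h'
  refine ⟨S ∪ S', hS.join hS' hadj hj, ?_⟩
  -- Partial sets need not lie inside their branches, so only the union bound is used.
  have := Finset.card_union_le S S'
  rw [Finset.card_union_of_disjoint hd]
  push_cast
  omega

/-- States in which the partial NTD-set is an NTD-set. -/
abbrev DomState.IsFinal (σ : DomState) : Prop :=
  (σ.2.2.2 → σ.2.1) ∧ (σ.1 || σ.2.1) ∧ (σ.1 || σ.2.2.1)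

theorem mem_openNbhd_iff {S : Finset V} {v : V} :
    v ∈ openNbhd G (S : Set V) ↔ HasNbrIn G S v := by
  simp [openNbhd, HasNbrIn, SimpleGraph.adj_comm]

/-- Members of `S` need no separate isolation check: if `v ∈ S` has a neighbour `u`, then `u ∈ N(S)`
because of `v` itself. -/
theorem isNTDSet_of_forall {S : Finset V} (h1 : ∀ v, v ∈ S ∨ HasNbrIn G S v)
    (h2 : ∀ v, v ∈ S ∨ ∃ u, G.Adj v u ∧ HasNbrIn G S u) : IsNTDSet G (S : Set V) := by
  refine ⟨fun v hv => (h1 v).resolve_left hv, ?_⟩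
  rintro ⟨v, hv⟩ hiso
  have : ∃ u, G.Adj v u ∧ HasNbrIn G S u := by
    rcases h2 v with hvS | h
    · obtain ⟨u, hu, huv⟩ := mem_openNbhd_iff.1 hv
      exact ⟨u, huv, v, hvS, huv.symm⟩
    · exact h
  obtain ⟨u, hu, hu'⟩ := this
  exact hiso ⟨u, mem_openNbhd_iff.2 hu'⟩ hu

theorem Attains.two_mul_ntdNumber_le [Fintype V] {r : V} {σ : DomState} {w : ℤ}
    (h : Attains G Finset.univ r σ w) (hσ : σ.IsFinal) :
    2 * (ntdNumber G : ℤ) ≤ Fintype.card V + w := by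
  obtain ⟨S, hS, hc⟩ := h
  obtain ⟨f1, f2, f3⟩ := hσ
  have hN : IsNTDSet G (S : Set V) := by
    refine isNTDSet_of_forall (fun v => ?_) (fun v => ?_)
    · by_cases hv : v = r
      · subst hv
        exact (Bool.or_eq_true_iff.1 f2).imp hS.mem_root hS.root_dom
      · exact hS.dom v (Finset.mem_univ v) hv
    · by_cases hv : v = r
      · subst hv
        exact (Bool.or_eq_true_iff.1 f3).imp hS.mem_root hS.root_near
      · refine (hS.near v (Finset.mem_univ v) hv).imp id ?_
        rintro ⟨u, hu, hu' | ⟨rfl, hb⟩⟩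
        · exact ⟨u, hu, hu'⟩
        · exact ⟨u, hu, hS.root_dom (f1 hb)⟩
  have : ntdNumber G ≤ S.card := Nat.sInf_le ⟨S, hN, rfl⟩
  rw [Finset.card_univ] at hc
  omega

end DominationStates

end NTD

namespace NTD

/-! ### Local labellings by roles and slots -/

section Roles

/-- The role of a vertex in a tree of the family: a vertex of the underlying tree (`base`), a
leaf of the base tree that may carry appended `P₂`s (`centre`), the two vertices of an appended
`P₂` (`inner`, `outer`), the centre of an added `P₃` (`claw`) and its end that carries nothing
(`tip`). -/
inductive Role
  | base | centre | inner | outer | claw | tip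
  deriving DecidableEq

/-- How a neighbour of role `q` is used by a vertex of role `p`: `none` means that there may be
arbitrarily many such neighbours, `some k` that the neighbour occupies slot `k`; slot `0` does
not exist for any role. -/
def slot : Role → Role → Option ℕ
  | .base, .base => none
  | .base, .centre => some 1
  | .base, .claw => some 1
  | .centre, .inner => none
  | .centre, .base => some 1
  | .centre, .claw => some 1
  | .inner, .centre => some 1
  | .inner, .outer => some 2
  | .outer, .inner => some 1
  | .claw, .base => some 1
  | .claw, .centre => some 2
  | .claw, .tip => some 3
  | .tip, .claw => some 1
  | _, _ => some 0

/-- The slots of a role that have to be occupied, each by exactly one neighbour. -/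
def Role.slots : Role → List ℕ
  | .base => [1]
  | .centre => [1]
  | .inner => [1, 2]
  | .outer => [1]
  | .claw => [1, 2, 3]
  | .tip => [1]

variable {V : Type u} {G : SimpleGraph V}

/-- The neighbours of `v` inside `s` occupy exactly the slots in `F`, each slot once. -/
def FilledAt (G : SimpleGraph V) (f : V → Role) (s : Finset V) (v : V) (F : List ℕ) : Prop :=
  (∀ u ∈ s, G.Adj v u → slot (f v) (f u) = none ∨ ∃ k ∈ F, slot (f v) (f u) = some k) ∧
  ∀ k ∈ F, ∃! u, (u ∈ s ∧ G.Adj v u) ∧ slot (f v) (f u) = some k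

/-- Adding a neighbour that is used as `o` changes the set of occupied slots from `F` to `F'`. -/
abbrev AddsTo (F : List ℕ) (o : Option ℕ) (F' : List ℕ) : Prop :=
  (o = none ∧ F' = F) ∨
    ((∃ k ∈ F', o = some k ∧ k ∉ F ∧ ∀ x ∈ F', x = k ∨ x ∈ F) ∧ ∀ x ∈ F, x ∈ F')

instance (F : List ℕ) (o : Option ℕ) (F' : List ℕ) : Decidable (AddsTo F o F') :=
  inferInstanceAs (Decidable (_ ∨ _))

theorem FilledAt.congr {f g : V → Role} {s s' : Finset V} {v : V} {F : List ℕ}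
    (h : FilledAt G f s v F) (hs : ∀ u, u ∈ s' ∧ G.Adj v u ↔ u ∈ s ∧ G.Adj v u)
    (hv : g v = f v) (hg : ∀ u ∈ s, g u = f u) : FilledAt G g s' v F := by
  refine ⟨fun u hu hvu => ?_, fun k hk => ?_⟩
  · have hu' := ((hs u).1 ⟨hu, hvu⟩).1
    rw [hv, hg u hu']
    exact h.1 u hu' hvu
  · obtain ⟨u, ⟨hu, huk⟩, huniq⟩ := h.2 k hk
    refine ⟨u, ⟨(hs u).2 hu, by rwa [hv, hg u hu.1]⟩, ?_⟩
    rintro w ⟨hw, hwk⟩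
    have hw' := (hs w).1 hw
    exact huniq w ⟨hw', by rwa [hv, hg w hw'.1] at hwk⟩

/-- The new neighbour `c` either uses no slot, or takes a slot `k` that was free, so uniqueness
survives in every slot. -/
theorem FilledAt.add {f g : V → Role} {s s' : Finset V} {v c : V} {F F' : List ℕ}
    (h : FilledAt G f s v F) (hs : ∀ u, u ∈ s' ∧ G.Adj v u ↔ (u ∈ s ∧ G.Adj v u) ∨ u = c)
    (hv : g v = f v) (hg : ∀ u ∈ s, g u = f u) (hF : AddsTo F (slot (g v) (g c)) F') :
    FilledAt G g s' v F' := by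
  have hcs : c ∈ s' ∧ G.Adj v c := (hs c).2 (.inr rfl)
  rcases hF with ⟨h0, rfl⟩ | ⟨⟨k, hk, hck, hkF, hF'⟩, hFF⟩
  · refine ⟨fun u hu hvu => ?_, fun k hk => ?_⟩
    · rcases (hs u).1 ⟨hu, hvu⟩ with hu' | rfl
      · rw [hv, hg u hu'.1]
        exact h.1 u hu'.1 hvu
      · exact .inl h0
    · obtain ⟨u, ⟨hu, huk⟩, huniq⟩ := h.2 k hk
      refine ⟨u, ⟨(hs u).2 (.inl hu), by rwa [hv, hg u hu.1]⟩, ?_⟩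
      rintro w ⟨hw, hwk⟩
      rcases (hs w).1 hw with hw' | rfl
      · exact huniq w ⟨hw', by rwa [hv, hg w hw'.1] at hwk⟩
      · simp [h0] at hwk
  · have notk : ∀ u ∈ s, G.Adj v u → slot (g v) (g u) ≠ some k := by
      intro u hu hvu he
      rw [hv, hg u hu] at he
      rcases h.1 u hu hvu with h1 | ⟨j, hj, h1⟩
      · simp [h1] at he
      · rw [h1, Option.some.injEq] at he
        exact hkF (he ▸ hj)
    refine ⟨fun u hu hvu => ?_, fun j hj => ?_⟩
    · rcases (hs u).1 ⟨hu, hvu⟩ with hu' | rfl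
      · rw [hv, hg u hu'.1]
        exact (h.1 u hu'.1 hvu).imp id fun ⟨j, hj, h1⟩ => ⟨j, hFF j hj, h1⟩
      · exact .inr ⟨k, hk, hck⟩
    · by_cases hjk : j = k
      · subst hjk
        refine ⟨c, ⟨hcs, hck⟩, ?_⟩
        rintro w ⟨hw, hwk⟩
        rcases (hs w).1 hw with hw' | rfl
        · exact absurd hwk (notk w hw'.1 hw'.2)
        · rfl
      · obtain ⟨u, ⟨hu, huk⟩, huniq⟩ := h.2 j ((hF' j hj).resolve_left hjk)
        refine ⟨u, ⟨(hs u).2 (.inl hu), by rwa [hv, hg u hu.1]⟩, ?_⟩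
        rintro w ⟨hw, hwk⟩
        rcases (hs w).1 hw with hw' | rfl
        · exact huniq w ⟨hw', by rwa [hv, hg w hw'.1] at hwk⟩
        · rw [hck, Option.some.injEq] at hwk
          exact absurd hwk.symm hjk

/-- The role of the root of a branch and the slots of the root that are occupied. -/
abbrev RoleState := Role × List ℕ

/-- The branch `s` has an assignment of roles that is complete except possibly at the root `r`,
which is in state `L`. -/
def HasRoles (G : SimpleGraph V) (s : Finset V) (r : V) (L : RoleState) : Prop :=
  ∃ f : V → Role, f r = L.1 ∧ FilledAt G f s r L.2 ∧
    ∀ v ∈ s, v ≠ r → FilledAt G f s v (f v).slots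

/-- Gluing the two labellings changes the neighbourhoods of `r` and `c` only. The slots of `c` must
be complete now, since no later join gives `c` a neighbour; those of `r` may stay incomplete. -/
theorem HasRoles.join [DecidableEq V] {s t : Finset V} {r c : V} {L M : RoleState} {F : List ℕ}
    (h : HasRoles G s r L) (h' : HasRoles G t c M) (hr : r ∈ s) (hc : c ∈ t)
    (hd : Disjoint s t) (hadj : G.Adj r c)
    (huniq : ∀ x ∈ s, ∀ y ∈ t, G.Adj x y → x = r ∧ y = c)
    (hF : AddsTo L.2 (slot L.1 M.1) F) (hM : AddsTo M.2 (slot M.1 L.1) M.1.slots) :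
    HasRoles G (s ∪ t) r (L.1, F) := by
  obtain ⟨f, hfr, hf, hfs⟩ := h
  obtain ⟨g, hgc, hg, hgt⟩ := h'
  have ht : ∀ x ∈ t, x ∉ s := fun x hx hx' => Finset.disjoint_left.1 hd hx' hx
  set e : V → Role := fun x => if x ∈ s then f x else g x with he
  have es : ∀ x ∈ s, e x = f x := fun x hx => if_pos hx
  have et : ∀ x ∈ t, e x = g x := fun x hx => if_neg (ht x hx)
  have er : e r = L.1 := (es r hr).trans hfr
  have ec : e c = M.1 := (et c hc).trans hgc
  refine ⟨e, er, ?_, fun v hv hvr => ?_⟩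
  · refine hf.add (c := c) (fun u => ?_) (es r hr) es (by rw [er, ec]; exact hF)
    rw [Finset.mem_union]
    constructor
    · rintro ⟨hu | hu, hru⟩
      · exact .inl ⟨hu, hru⟩
      · exact .inr (huniq r hr u hu hru).2
    · rintro (⟨hu, hru⟩ | rfl)
      · exact ⟨.inl hu, hru⟩
      · exact ⟨.inr hc, hadj⟩
  · rcases Finset.mem_union.1 hv with hv | hv
    · rw [es v hv]
      refine (hfs v hv hvr).congr (fun u => ?_) (es v hv) es
      rw [Finset.mem_union]
      constructor
      · rintro ⟨hu | hu, hvu⟩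
        · exact ⟨hu, hvu⟩
        · exact absurd (huniq v hv u hu hvu).1 hvr
      · exact fun h => ⟨.inl h.1, h.2⟩
    · rw [et v hv]
      by_cases hvc : v = c
      · subst hvc
        rw [hgc]
        refine hg.add (c := r) (fun u => ?_) (et v hv) et (by rw [er, ec]; exact hM)
        rw [Finset.mem_union]
        constructor
        · rintro ⟨hu | hu, hvu⟩
          · exact .inr (huniq u hu v hv hvu.symm).1
          · exact .inl ⟨hu, hvu⟩
        · rintro (⟨hu, hvu⟩ | rfl)
          · exact ⟨.inr hu, hvu⟩
          · exact ⟨.inl hr, hadj.symm⟩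
      · refine (hgt v hv hvc).congr (fun u => ?_) (et v hv) et
        rw [Finset.mem_union]
        constructor
        · rintro ⟨hu | hu, hvu⟩
          · exact absurd (huniq u hu v hv hvu.symm).2 hvc
          · exact ⟨hu, hvu⟩
        · exact fun h => ⟨.inr h.1, h.2⟩

end Roles

/-! ### The finite list of branch classes -/

section BranchClasses

namespace DomState

/-- The root is neither in `S` nor dominated yet. -/
def undominated : DomState := (false, false, false, true)
/-- The root is not dominated, but has a neighbour in `N(S)`. -/
def near : DomState := (false, false, true, true)
/-- The root is dominated, but has no neighbour in `N(S)` yet. -/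
def dominated : DomState := (false, true, false, true)
/-- The root is dominated and has a neighbour in `N(S)`. -/
def satisfied : DomState := (false, true, true, true)
/-- The root belongs to `S`. -/
def lonely : DomState := (true, false, false, false)
/-- The root belongs to `S` and has to get a neighbour in `S`. -/
def promised : DomState := (true, false, false, true)
/-- The root belongs to `S` and has a neighbour in `S`. -/
def paired : DomState := (true, true, false, true)

end DomState

/-- Facts about a rooted branch: states attained by partial NTD-sets with their weights, states
of role assignments, and the possible residues modulo two of the order. -/
structure BranchClass where
  dom : List (DomState × ℤ)
  roles : List RoleState
  parity : List ℕ

/-- The branch `s` with root `r` has all the properties recorded in `C`. -/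
structure BranchClass.Holds (C : BranchClass) (G : SimpleGraph V) (s : Finset V) (r : V) :
    Prop where
  dom : ∀ x ∈ C.dom, Attains G s r x.1 x.2
  roles : ∀ L ∈ C.roles, HasRoles G s r L
  parity : s.card % 2 ∈ C.parity

/-- Joining a branch of class `B` to a branch of class `A` gives a branch of class `C`. -/
abbrev BranchClass.Combines (A B C : BranchClass) : Prop :=
  (∀ x ∈ C.dom, ∃ a ∈ A.dom, ∃ b ∈ B.dom, JoinsTo a.1 b.1 x.1 ∧ a.2 + b.2 ≤ x.2) ∧
  (∀ L ∈ C.roles, ∃ a ∈ A.roles, ∃ b ∈ B.roles, a.1 = L.1 ∧ AddsTo a.2 (slot a.1 b.1) L.2 ∧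
    AddsTo b.2 (slot b.1 a.1) b.1.slots) ∧
  ∀ p ∈ A.parity, ∀ q ∈ B.parity, (p + q) % 2 ∈ C.parity

instance (σ τ ρ : DomState) : Decidable (JoinsTo σ τ ρ) :=
  inferInstanceAs (Decidable (_ ∧ _))

instance (A B C : BranchClass) : Decidable (A.Combines B C) :=
  inferInstanceAs (Decidable (_ ∧ _ ∧ _))

theorem BranchClass.Combines.holds {V : Type u} {G : SimpleGraph V} [DecidableEq V]
    {A B C : BranchClass} (hC : A.Combines B C) {s t : Finset V} {r c : V}
    (hA : A.Holds G s r) (hB : B.Holds G t c) (hr : r ∈ s) (hc : c ∈ t)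
    (hd : Disjoint s t) (hadj : G.Adj r c)
    (huniq : ∀ x ∈ s, ∀ y ∈ t, G.Adj x y → x = r ∧ y = c) : C.Holds G (s ∪ t) r := by
  refine ⟨fun x hx => ?_, fun L hL => ?_, ?_⟩
  · obtain ⟨a, ha, b, hb, hj, hw⟩ := hC.1 x hx
    exact (hA.dom a ha).join (hB.dom b hb) hd hadj hj hw
  · obtain ⟨a, ha, b, hb, he, h1, h2⟩ := hC.2.1 L hL
    have := (hA.roles a ha).join (hB.roles b hb) hr hc hd hadj huniq h1 h2
    rwa [he] at this
  · have := hC.2.2 _ hA.parity _ hB.parity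
    rwa [Finset.card_union_of_disjoint hd, Nat.add_mod]

open DomState in
/-- The class of a single vertex. -/
def singleClass : BranchClass :=
  ⟨[(undominated, -1), (lonely, 1), (promised, 1)],
    [(.base, []), (.centre, []), (.inner, []), (.outer, []), (.claw, []), (.tip, [])], [1]⟩

open DomState in
/-- Classes of branches, closed under joining. -/
def branchClasses : List BranchClass :=
  [singleClass,
   ⟨[(dominated, -2), (paired, 0)],
      [(.tip, [1])], [0, 1]⟩,
   ⟨[(paired, 0)],
      [(.base, [1])], [0]⟩,
   ⟨[(near, -1), (dominated, -1), (paired, 1)],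
      [(.base, [])], [1]⟩,
   ⟨[(satisfied, -1), (promised, -2)],
      [], [0, 1]⟩,
   ⟨[(lonely, -1), (paired, 0)],
      [], [0, 1]⟩,
   ⟨[(near, -1), (paired, 1)],
      [(.base, []), (.centre, [])], [1]⟩,
   ⟨[(paired, -1)],
      [], [0, 1]⟩,
   ⟨[(dominated, 0), (lonely, 0), (promised, 0)],
      [(.base, [1]), (.claw, [2])], [0]⟩,
   ⟨[(promised, -2)],
      [(.claw, [1, 2, 3])], [0, 1]⟩,
   ⟨[(undominated, -2), (satisfied, -1), (paired, 0)],
      [], [0, 1]⟩,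
   ⟨[(promised, -1)],
      [(.claw, [2, 3])], [1]⟩,
   ⟨[(dominated, 0), (promised, 0)],
      [(.base, [1]), (.inner, [2]), (.claw, [3])], [0]⟩,
   ⟨[(promised, -2)],
      [(.inner, [1, 2])], [0, 1]⟩,
   ⟨[(lonely, -1), (promised, -1)],
      [(.claw, [1, 2])], [0, 1]⟩,
   ⟨[(dominated, -2), (paired, 0)],
      [(.outer, [1])], [0, 1]⟩,
   ⟨[(lonely, -1), (promised, -1)],
      [(.inner, [1])], [0, 1]⟩,
   ⟨[(near, -2), (paired, 0)],
      [(.centre, [1])], [0, 1]⟩,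
   ⟨[(near, -2), (satisfied, -1), (promised, -1)],
      [], [0, 1]⟩,
   ⟨[(near, -2), (lonely, 0), (promised, 0)],
      [(.centre, [1]), (.claw, [1])], [0, 1]⟩,
   ⟨[(satisfied, -1), (promised, -1)],
      [(.claw, [1, 3])], [0, 1]⟩]

/-- A finite check over ordered pairs of classes. The class `C` may forget evidence or weaken
bounds, which is what lets a finite list be closed. -/
theorem branchClasses_closed : ∀ A ∈ branchClasses, ∀ B ∈ branchClasses,
    ∃ C ∈ branchClasses, A.Combines B C := by
  decide +kernel

theorem branchClasses_final : ∀ A ∈ branchClasses,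
    (∃ x ∈ A.dom, x.1.IsFinal ∧ x.2 < 0) ∨ (∃ L ∈ A.roles, L.2 = L.1.slots) ∨
      A.parity = [1] := by
  decide +kernel

theorem singleClass_holds {V : Type u} (G : SimpleGraph V) (v : V) :
    singleClass.Holds G {v} v := by
  classical
  have hroles : ∀ p : Role, HasRoles G {v} v (p, []) := fun p =>
    ⟨fun _ => p, rfl, ⟨fun u hu hvu => absurd hvu (by simp [Finset.mem_singleton.1 hu]),
      by simp⟩, fun u hu hne => absurd (Finset.mem_singleton.1 hu) hne⟩
  have hne : ∀ u ∈ ({v} : Finset V), u ≠ v → False := fun u hu h => h (Finset.mem_singleton.1 hu)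
  -- The promise flag `b` is free here: no other vertex is present to rely on it.
  have hin : ∀ b : Bool, Attains G {v} v (true, false, false, b) 1 := fun b =>
    ⟨{v}, ⟨by simp, by simp, by simp, fun u hu h => (hne u hu h).elim,
      fun u hu h => (hne u hu h).elim⟩, by simp⟩
  refine ⟨?_, ?_, by simp [singleClass]⟩
  · simp only [singleClass, List.forall_mem_cons]
    refine ⟨⟨∅, ⟨?_, ?_, ?_, fun u hu h => (hne u hu h).elim,
      fun u hu h => (hne u hu h).elim⟩, by simp⟩, hin _, hin _, by simp⟩ <;>
    simp [DomState.undominated]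
  · simp only [singleClass, List.forall_mem_cons]
    exact ⟨hroles _, hroles _, hroles _, hroles _, hroles _, hroles _, by simp⟩

theorem Branch.exists_class {V : Type u} {G : SimpleGraph V} [DecidableEq V] {s : Finset V}
    {r : V} (h : Branch G s r) : ∃ C ∈ branchClasses, C.Holds G s r := by
  induction h with
  | single v => exact ⟨singleClass, List.mem_cons_self, singleClass_holds G v⟩
  | join hs ht hd hadj huniq ih ih' =>
    obtain ⟨A, hA, hA'⟩ := ih
    obtain ⟨B, hB, hB'⟩ := ih'
    obtain ⟨C, hC, hABC⟩ := branchClasses_closed A hA B hB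
    exact ⟨C, hC, hABC.holds hA' hB' hs.root_mem ht.root_mem hd hadj huniq⟩

/-- A tree whose neighborhood total domination number is half its order admits a complete
assignment of roles. -/
theorem exists_roles_of_two_mul_ntdNumber {V : Type u} [Fintype V] {T : SimpleGraph V}
    (hT : T.IsTree) (hγ : 2 * ntdNumber T = Fintype.card V) :
    ∃ f : V → Role, ∀ v, FilledAt T f Finset.univ v (f v).slots := by
  classical
  obtain ⟨r⟩ := hT.connected.nonempty
  obtain ⟨C, hC, hH⟩ := (hT.branch_univ r).exists_class
  -- A final state of negative weight gives `2γ < n`, and odd order contradicts `2γ = n`; only the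
  -- labelling remains.
  rcases branchClasses_final C hC with ⟨x, hx, hfin, hw⟩ | ⟨L, hL, hfull⟩ | hpar
  · have := (hH.dom x hx).two_mul_ntdNumber_le hfin
    omega
  · obtain ⟨f, hfr, hf, hfs⟩ := hH.roles L hL
    refine ⟨f, fun v => ?_⟩
    by_cases hv : v = r
    · subst hv
      rwa [hfr, ← hfull]
    · exact hfs v (Finset.mem_univ v) hv
  · have := hH.parity
    rw [hpar, List.mem_singleton, Finset.card_univ] at this
    omega

end BranchClasses

end NTD

namespace NTD

/-! ### Reconstruction of the tree from its labelling -/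

section Assembly

variable {V : Type u} {T : SimpleGraph V} {f : V → Role} {occ : V → ℕ → V}

/-- `f` assigns roles to the vertices of `T` such that `occ v k` is the unique neighbour
occupying slot `k` of `v`. For a vertex that is not a base vertex, `occ v 1` is its parent. -/
structure IsRoleAssignment (T : SimpleGraph V) (f : V → Role) (occ : V → ℕ → V) : Prop where
  adj_occ : ∀ v, ∀ k ∈ (f v).slots, T.Adj v (occ v k)
  slot_occ : ∀ v, ∀ k ∈ (f v).slots, slot (f v) (f (occ v k)) = some k
  occ_eq : ∀ {v u k}, k ∈ (f v).slots → T.Adj v u → slot (f v) (f u) = some k → occ v k = u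
  slot_ne : ∀ {v u}, T.Adj v u → slot (f v) (f u) ≠ some 0

theorem exists_isRoleAssignment [Fintype V]
    (h : ∀ v, FilledAt T f Finset.univ v (f v).slots) : ∃ occ, IsRoleAssignment T f occ := by
  classical
  have hex : ∀ v k, ∃ u, k ∈ (f v).slots →
      (T.Adj v u ∧ slot (f v) (f u) = some k) ∧
        ∀ w, T.Adj v w → slot (f v) (f w) = some k → u = w := by
    intro v k
    by_cases hk : k ∈ (f v).slots
    · obtain ⟨u, ⟨hu, hs⟩, huniq⟩ := (h v).2 k hk
      exact ⟨u, fun _ => ⟨⟨hu.2, hs⟩, fun w hw hw' =>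
        (huniq w ⟨⟨Finset.mem_univ w, hw⟩, hw'⟩).symm⟩⟩
    -- An arbitrary value: `occ v k` matters only for slots that `v` has.
    · exact ⟨v, fun h => absurd h hk⟩
  choose occ hocc using hex
  refine ⟨occ, fun v k hk => (hocc v k hk).1.1, fun v k hk => (hocc v k hk).1.2,
    fun hk hu hs => (hocc _ _ hk).2 _ hu hs, fun {v u} hu h0 => ?_⟩
  rcases (h v).1 u (Finset.mem_univ u) hu with h1 | ⟨k, hk, h1⟩
  · simp [h1] at h0
  · rw [h1, Option.some.injEq] at h0
    subst h0
    revert hk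
    cases f v <;> simp [Role.slots]

theorem Role.one_mem_slots (p : Role) : 1 ∈ p.slots := by
  cases p <;> simp [Role.slots]

namespace IsRoleAssignment

theorem adj_parent (h : IsRoleAssignment T f occ) (v : V) : T.Adj v (occ v 1) :=
  h.adj_occ v 1 (f v).one_mem_slots

/-- Every edge joins two base vertices or a vertex and its parent. -/
theorem edge_cases (h : IsRoleAssignment T f occ) {u v : V} (huv : T.Adj u v) :
    (f u = .base ∧ f v = .base) ∨ (f u ≠ .base ∧ occ u 1 = v) ∨ (f v ≠ .base ∧ occ v 1 = u) := by
  have h1 := h.slot_ne huv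
  have h2 := fun hs => h.occ_eq (f u).one_mem_slots huv hs
  have h3 := fun hs => h.occ_eq (f v).one_mem_slots huv.symm hs
  revert h1 h2 h3
  cases f u <;> cases f v <;> simp [slot] <;> tauto

/-- An edge is read from both ends: the occupant of a slot sees its owner in a slot of its own, and
uniqueness of occupants makes the two maps mutually inverse. The similar lemmas below are the same
finite check on the table `slot`. -/
theorem parent_base (h : IsRoleAssignment T f occ) {x : V} (hx : f x = .base) :
    (f (occ x 1) = .centre ∨ f (occ x 1) = .claw) ∧ occ (occ x 1) 1 = x := by
  have h1 := h.slot_occ x 1 (f x).one_mem_slots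
  have h2 := fun hs => h.occ_eq (f (occ x 1)).one_mem_slots (h.adj_parent x).symm hs
  rw [hx] at h1 h2
  revert h1 h2
  cases f (occ x 1) <;> simp [slot]

theorem claw_two (h : IsRoleAssignment T f occ) {c : V} (hc : f c = .claw) :
    T.Adj c (occ c 2) ∧ f (occ c 2) = .centre ∧ occ (occ c 2) 1 = c := by
  have hm : 2 ∈ (f c).slots := by rw [hc]; simp [Role.slots]
  have h0 := h.adj_occ c 2 hm
  have h1 := h.slot_occ c 2 hm
  have h2 := fun hs => h.occ_eq (f (occ c 2)).one_mem_slots h0.symm hs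
  refine ⟨h0, ?_⟩
  rw [hc] at h1 h2
  revert h1 h2
  cases f (occ c 2) <;> simp [slot]

theorem claw_three (h : IsRoleAssignment T f occ) {c : V} (hc : f c = .claw) :
    T.Adj c (occ c 3) ∧ f (occ c 3) = .tip ∧ occ (occ c 3) 1 = c := by
  have hm : 3 ∈ (f c).slots := by rw [hc]; simp [Role.slots]
  have h0 := h.adj_occ c 3 hm
  have h1 := h.slot_occ c 3 hm
  have h2 := fun hs => h.occ_eq (f (occ c 3)).one_mem_slots h0.symm hs
  refine ⟨h0, ?_⟩
  rw [hc] at h1 h2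
  revert h1 h2
  cases f (occ c 3) <;> simp [slot]

theorem inner_two (h : IsRoleAssignment T f occ) {w : V} (hw : f w = .inner) :
    T.Adj w (occ w 2) ∧ f (occ w 2) = .outer ∧ occ (occ w 2) 1 = w := by
  have hm : 2 ∈ (f w).slots := by rw [hw]; simp [Role.slots]
  have h0 := h.adj_occ w 2 hm
  have h1 := h.slot_occ w 2 hm
  have h2 := fun hs => h.occ_eq (f (occ w 2)).one_mem_slots h0.symm hs
  refine ⟨h0, ?_⟩
  rw [hw] at h1 h2
  revert h1 h2
  cases f (occ w 2) <;> simp [slot]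

theorem parent_claw (h : IsRoleAssignment T f occ) {c : V} (hc : f c = .claw) :
    f (occ c 1) = .base ∧ occ (occ c 1) 1 = c := by
  have h1 := h.slot_occ c 1 (f c).one_mem_slots
  have h2 := fun hs => h.occ_eq (f (occ c 1)).one_mem_slots (h.adj_parent c).symm hs
  rw [hc] at h1 h2
  revert h1 h2
  cases f (occ c 1) <;> simp [slot]

theorem parent_centre (h : IsRoleAssignment T f occ) {z : V} (hz : f z = .centre) :
    (f (occ z 1) = .base ∧ occ (occ z 1) 1 = z) ∨
      (f (occ z 1) = .claw ∧ occ (occ z 1) 2 = z) := by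
  have h1 := h.slot_occ z 1 (f z).one_mem_slots
  have h2 := fun k hk hs => h.occ_eq (k := k) hk (h.adj_parent z).symm hs
  rw [hz] at h1 h2
  revert h1 h2
  cases f (occ z 1) <;> simp [slot, Role.slots]

theorem parent_tip (h : IsRoleAssignment T f occ) {z : V} (hz : f z = .tip) :
    f (occ z 1) = .claw ∧ occ (occ z 1) 3 = z := by
  have h1 := h.slot_occ z 1 (f z).one_mem_slots
  have h2 := fun k hk hs => h.occ_eq (k := k) hk (h.adj_parent z).symm hs
  rw [hz] at h1 h2
  revert h1 h2
  cases f (occ z 1) <;> simp [slot, Role.slots]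

theorem parent_outer (h : IsRoleAssignment T f occ) {z : V} (hz : f z = .outer) :
    f (occ z 1) = .inner ∧ occ (occ z 1) 2 = z := by
  have h1 := h.slot_occ z 1 (f z).one_mem_slots
  have h2 := fun k hk hs => h.occ_eq (k := k) hk (h.adj_parent z).symm hs
  rw [hz] at h1 h2
  revert h1 h2
  cases f (occ z 1) <;> simp [slot, Role.slots]

theorem parent_inner (h : IsRoleAssignment T f occ) {w : V} (hw : f w = .inner) :
    f (occ w 1) = .centre := by
  have h1 := h.slot_occ w 1 (f w).one_mem_slots
  rw [hw] at h1
  revert h1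
  cases f (occ w 1) <;> simp [slot]

theorem parent_eq_of_centre_inner (h : IsRoleAssignment T f occ) {z w : V}
    (hz : f z = .centre) (hw : f w = .inner) (hzw : T.Adj z w) : occ w 1 = z :=
  h.occ_eq (f w).one_mem_slots hzw.symm (by rw [hz, hw]; rfl)

end IsRoleAssignment

/-- The base vertices that are joined to the centre of an added `P₃`. -/
def clawed (f : V → Role) (occ : V → ℕ → V) : Set {x // f x = .base} :=
  {x | f (occ x 1) = .claw}

/-- The vertex of `T` corresponding to a vertex of the base tree. -/
def basePlace (f : V → Role) (occ : V → ℕ → V) : BaseVertex (clawed f occ) → V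
  | .under x => x
  | .attached x => occ x 1
  | .tip x _ true => occ (occ x 1) 2
  | .tip x _ false => occ (occ x 1) 3

/-- The leaves of the base tree to which `P₂`s are appended. -/
def carriers (f : V → Role) (occ : V → ℕ → V) : Set (BaseVertex (clawed f occ)) :=
  {b | f (basePlace f occ b) = .centre}

/-- The appended `P₂`s at a vertex of the base tree, given by their ends next to it. -/
abbrev InnerAt (T : SimpleGraph V) (f : V → Role) (occ : V → ℕ → V)
    (b : BaseVertex (clawed f occ)) : Type u :=
  {w : V // T.Adj (basePlace f occ b) w ∧ f w = .inner}

/-- The number of `P₂`s appended at a vertex of the base tree. -/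
noncomputable def innerCount (T : SimpleGraph V) (f : V → Role) (occ : V → ℕ → V)
    (b : BaseVertex (clawed f occ)) : ℕ :=
  Nat.card (InnerAt T f occ b)

/-- The vertex of `T` corresponding to a vertex of the reconstructed tree. -/
noncomputable def place [Finite V] (T : SimpleGraph V) (f : V → Role) (occ : V → ℕ → V) :
    AppendVertex (carriers f occ) (innerCount T f occ) → V
  | .old b => basePlace f occ b
  | .near b _ i => ((Finite.equivFin (InnerAt T f occ b)).symm i).1
  | .far b _ i => occ ((Finite.equivFin (InnerAt T f occ b)).symm i).1 2

namespace IsRoleAssignment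

theorem basePlace_attached (h : IsRoleAssignment T f occ) (x : {x // f x = .base}) :
    (f (basePlace f occ (.attached x)) = .centre ∨ f (basePlace f occ (.attached x)) = .claw) ∧
      occ (basePlace f occ (.attached x)) 1 = x :=
  h.parent_base x.2

theorem basePlace_tip (h : IsRoleAssignment T f occ) (x : {x // f x = .base})
    (hx : x ∈ clawed f occ) (b : Bool) :
    T.Adj (occ x 1) (basePlace f occ (.tip x hx b)) ∧
    f (basePlace f occ (.tip x hx b)) = (if b then .centre else .tip) ∧
      occ (basePlace f occ (.tip x hx b)) 1 = occ x 1 := by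
  cases b
  · exact h.claw_three hx
  · exact h.claw_two hx

theorem role_basePlace (h : IsRoleAssignment T f occ) (b : BaseVertex (clawed f occ)) :
    f (basePlace f occ b) ≠ .inner ∧ f (basePlace f occ b) ≠ .outer := by
  rcases b with x | x | ⟨x, hx, b⟩
  · simp [basePlace, x.2]
  · rcases (h.basePlace_attached x).1 with h | h <;> simp [h]
  · rw [(h.basePlace_tip x hx b).2.1]
    cases b <;> simp

theorem basePlace_injective (h : IsRoleAssignment T f occ) :
    Function.Injective (basePlace f occ) := by
  -- Both kinds of vertex can be centres, so they are told apart by the role of the parent: base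
  -- against claw.
  have key : ∀ x y hy b, basePlace f occ (.attached x) ≠ basePlace f occ (.tip y hy b) := by
    intro x y hy b he
    have h1 := congrArg (fun v => f (occ v 1)) he
    simp only [(h.basePlace_attached x).2, (h.basePlace_tip y hy b).2.2, x.2] at h1
    rw [show f (occ y 1) = .claw from hy] at h1
    cases h1
  have key1 : ∀ x y, basePlace f occ (.under x) ≠ basePlace f occ (.attached y) := by
    intro x y he
    have h1 := (h.basePlace_attached y).1
    rw [← he] at h1
    simp [basePlace, x.2] at h1
  have key2 : ∀ x y hy b, basePlace f occ (.under x) ≠ basePlace f occ (.tip y hy b) := by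
    intro x y hy b he
    have h1 := (h.basePlace_tip y hy b).2.1
    rw [← he] at h1
    cases b <;> simp [basePlace, x.2] at h1
  rintro (x | x | ⟨x, hx, b⟩) (y | y | ⟨y, hy, b'⟩) he
  · rw [Subtype.ext (show x.1 = y.1 from he)]
  · exact absurd he (key1 _ _)
  · exact absurd he (key2 _ _ _ _)
  · exact absurd he.symm (key1 _ _)
  · have h1 := congrArg (occ · 1) he
    simp only [(h.basePlace_attached _).2] at h1
    rw [Subtype.ext h1]
  · exact absurd he (key _ _ _ _)
  · exact absurd he.symm (key2 _ _ _ _)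
  · exact absurd he.symm (key _ _ _ _)
  · have h1 := congrArg (fun v => occ (occ v 1) 1) he
    simp only [(h.basePlace_tip _ _ _).2.2, (h.parent_base x.2).2, (h.parent_base y.2).2] at h1
    obtain rfl := Subtype.ext h1
    -- The two ends of a `P₃` share their claw; their roles, centre and tip, recover the Boolean.
    have h2 := congrArg f he
    rw [(h.basePlace_tip _ _ _).2.1, (h.basePlace_tip _ _ _).2.1] at h2
    cases b <;> cases b' <;> simp at h2 ⊢

theorem adj_basePlace_of_rel (h : IsRoleAssignment T f occ) {a b : BaseVertex (clawed f occ)}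
    (hab : BaseRel (T.comap Subtype.val) (clawed f occ) a b) :
    T.Adj (basePlace f occ a) (basePlace f occ b) := by
  cases hab with
  | under h => exact h
  | attached x => exact h.adj_parent x
  | tip x hx b => exact (h.basePlace_tip x hx b).1

theorem adj_basePlace (h : IsRoleAssignment T f occ) {a b : BaseVertex (clawed f occ)}
    (hab : (baseTree (T.comap Subtype.val) (clawed f occ)).Adj a b) :
    T.Adj (basePlace f occ a) (basePlace f occ b) := by
  rcases ((SimpleGraph.fromRel_adj _ _ _).1 hab).2 with h1 | h1
  · exact h.adj_basePlace_of_rel h1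
  · exact (h.adj_basePlace_of_rel h1).symm

theorem exists_base_parent (h : IsRoleAssignment T f occ) {a : BaseVertex (clawed f occ)}
    (ha : f (basePlace f occ a) ≠ .base) :
    ∃ b, basePlace f occ b = occ (basePlace f occ a) 1 ∧
      (baseTree (T.comap Subtype.val) (clawed f occ)).Adj b a := by
  rcases a with x | x | ⟨x, hx, b⟩
  · exact absurd x.2 ha
  · exact ⟨.under x, (h.basePlace_attached x).2.symm,
      (SimpleGraph.fromRel_adj _ _ _).2 ⟨by simp, .inl (.attached x)⟩⟩
  · exact ⟨.attached x, (h.basePlace_tip x hx b).2.2.symm,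
      (SimpleGraph.fromRel_adj _ _ _).2 ⟨by simp, .inl (.tip x hx b)⟩⟩

/-- A centre's neighbours are its parent and inner vertices, and no vertex of the base tree is
placed at an inner vertex. -/
theorem basePlace_eq_parent (h : IsRoleAssignment T f occ) {a b : BaseVertex (clawed f occ)}
    (ha : a ∈ carriers f occ)
    (hab : (baseTree (T.comap Subtype.val) (clawed f occ)).Adj a b) :
    basePlace f occ b = occ (basePlace f occ a) 1 := by
  have ha' : f (basePlace f occ a) = .centre := ha
  have hadj := h.adj_basePlace hab
  refine (h.occ_eq (Role.one_mem_slots _) hadj ?_).symm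
  have h1 := h.slot_ne hadj
  have h2 := (h.role_basePlace b).1
  rw [ha'] at h1 ⊢
  revert h1 h2
  cases f (basePlace f occ b) <;> simp [slot]

theorem isLeaf_of_mem_carriers (h : IsRoleAssignment T f occ) {a : BaseVertex (clawed f occ)}
    (ha : a ∈ carriers f occ) : IsLeaf (baseTree (T.comap Subtype.val) (clawed f occ)) a := by
  have ha' : f (basePlace f occ a) = .centre := ha
  obtain ⟨b, hb, hba⟩ := h.exists_base_parent (a := a) (by simp [ha'])
  refine Set.ncard_eq_one.2 ⟨b, Set.eq_singleton_iff_unique_mem.2 ⟨hba.symm, fun w hw => ?_⟩⟩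
  exact h.basePlace_injective ((h.basePlace_eq_parent ha hw).trans hb.symm)

/-- Centres are never adjacent, and the middle of a walk of length two between centres would be
their common parent, a base or claw vertex with a single slot for a centre. -/
theorem isTwoPacking_carriers (h : IsRoleAssignment T f occ) :
    IsTwoPacking (baseTree (T.comap Subtype.val) (clawed f occ)) (carriers f occ) := by
  intro a ha b hb hne
  by_contra hlt
  rw [not_le] at hlt
  obtain ⟨w, hw⟩ := SimpleGraph.exists_walk_of_edist_ne_top hlt.ne_top
  rw [← hw] at hlt
  have ha' : f (basePlace f occ a) = .centre := ha
  have hb' : f (basePlace f occ b) = .centre := hb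
  have hlen : w.length < 3 := by exact_mod_cast hlt
  rcases w with _ | ⟨h1, _ | ⟨h2, _ | ⟨h3, w⟩⟩⟩
  · exact hne rfl
  · exact h.slot_ne (h.adj_basePlace h1) (by rw [ha', hb']; rfl)
  · have e1 := h.basePlace_eq_parent ha h1
    have e2 := h.basePlace_eq_parent hb h2.symm
    apply hne
    apply h.basePlace_injective
    rcases h.parent_centre ha' with ⟨p1, q1⟩ | ⟨p1, q1⟩ <;>
    rcases h.parent_centre hb' with ⟨p2, q2⟩ | ⟨p2, q2⟩ <;> rw [← e1] at p1 q1 <;>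
    rw [← e2] at p2 q2
    · exact q1.symm.trans q2
    · rw [p1] at p2; cases p2
    · rw [p1] at p2; cases p2
    · exact q1.symm.trans q2
  · simp only [SimpleGraph.Walk.length_cons] at hlen
    omega

/-! ### The isomorphism with the rebuilt tree -/

section Place

variable [Finite V]

theorem role_place_near (b : BaseVertex (clawed f occ)) (hb : b ∈ carriers f occ)
    (i : Fin (innerCount T f occ b)) :
    T.Adj (basePlace f occ b) (place T f occ (.near b hb i)) ∧
      f (place T f occ (.near b hb i)) = .inner :=
  ((Finite.equivFin (InnerAt T f occ b)).symm i).2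

theorem parent_place_near (h : IsRoleAssignment T f occ) (b : BaseVertex (clawed f occ))
    (hb : b ∈ carriers f occ) (i : Fin (innerCount T f occ b)) :
    occ (place T f occ (.near b hb i)) 1 = basePlace f occ b :=
  h.parent_eq_of_centre_inner hb (role_place_near b hb i).2 (role_place_near b hb i).1

theorem role_place_far (h : IsRoleAssignment T f occ) (b : BaseVertex (clawed f occ))
    (hb : b ∈ carriers f occ) (i : Fin (innerCount T f occ b)) :
    T.Adj (place T f occ (.near b hb i)) (place T f occ (.far b hb i)) ∧
      f (place T f occ (.far b hb i)) = .outer ∧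
        occ (place T f occ (.far b hb i)) 1 = place T f occ (.near b hb i) :=
  h.inner_two (role_place_near b hb i).2

theorem place_injective (h : IsRoleAssignment T f occ) : Function.Injective (place T f occ) := by
  have near_inj : ∀ b hb i b' hb' i', place T f occ (.near b hb i) = place T f occ (.near b' hb' i') →
      (AppendVertex.near b hb i : AppendVertex (carriers f occ) (innerCount T f occ)) =
        .near b' hb' i' := by
    intro b hb i b' hb' i' he
    have h1 := congrArg (occ · 1) he
    simp only [h.parent_place_near] at h1
    obtain rfl := h.basePlace_injective h1
    rw [(Finite.equivFin (InnerAt T f occ b)).symm.injective (Subtype.ext he)]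
  have k1 : ∀ a b hb i, place T f occ (.old a) ≠ place T f occ (.near b hb i) :=
    fun a b hb i he => (h.role_basePlace a).1 ((congrArg f he).trans (role_place_near b hb i).2)
  have k2 : ∀ a b hb i, place T f occ (.old a) ≠ place T f occ (.far b hb i) :=
    fun a b hb i he => (h.role_basePlace a).2 ((congrArg f he).trans (h.role_place_far b hb i).2.1)
  have k3 : ∀ a ha j b hb i, place T f occ (.near a ha j) ≠ place T f occ (.far b hb i) := by
    intro a ha j b hb i he
    have := congrArg f he
    rw [(role_place_near a ha j).2, (h.role_place_far b hb i).2.1] at this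
    cases this
  rintro (a | ⟨a, ha, j⟩ | ⟨a, ha, j⟩) (b | ⟨b, hb, i⟩ | ⟨b, hb, i⟩) he
  · rw [h.basePlace_injective he]
  · exact absurd he (k1 _ _ _ _)
  · exact absurd he (k2 _ _ _ _)
  · exact absurd he.symm (k1 _ _ _ _)
  · exact near_inj _ _ _ _ _ _ he
  · exact absurd he (k3 _ _ _ _ _ _)
  · exact absurd he.symm (k2 _ _ _ _)
  · exact absurd he.symm (k3 _ _ _ _ _ _)
  · have h1 := congrArg (occ · 1) he
    simp only [(h.role_place_far _ _ _).2.2] at h1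
    have h2 := near_inj _ _ _ _ _ _ h1
    cases h2
    rfl

/-- Following parents from any vertex leads back to a base vertex; the route and the slots along it
name the preimage. -/
theorem place_surjective (h : IsRoleAssignment T f occ) :
    Function.Surjective (place T f occ) := by
  have hclaw : ∀ c, f c = .claw → ∃ x, x ∈ clawed f occ ∧ occ x 1 = c := fun c hc =>
    ⟨⟨occ c 1, (h.parent_claw hc).1⟩, by
      rw [clawed, Set.mem_ofPred_eq, (h.parent_claw hc).2, hc], (h.parent_claw hc).2⟩
  have hcentre : ∀ z, f z = .centre → ∃ b, basePlace f occ b = z := by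
    intro z hz
    rcases h.parent_centre hz with ⟨h1, h2⟩ | ⟨h1, h2⟩
    · exact ⟨.attached ⟨occ z 1, h1⟩, h2⟩
    · obtain ⟨x, hx, hxc⟩ := hclaw _ h1
      exact ⟨.tip x hx true, by rw [basePlace, hxc, h2]⟩
  have hinner : ∀ w, f w = .inner → ∃ b hb i, place T f occ (.near b hb i) = w := by
    intro w hw
    obtain ⟨b, hb⟩ := hcentre _ (h.parent_inner hw)
    refine ⟨b, ?_, Finite.equivFin (InnerAt T f occ b) ⟨w, ?_, hw⟩, ?_⟩
    · rw [carriers, Set.mem_ofPred_eq, hb, h.parent_inner hw]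
    · rw [hb]
      exact (h.adj_parent w).symm
    · simp [place]
  intro v
  rcases hv : f v with _ | _ | _ | _ | _ | _
  · exact ⟨.old (.under ⟨v, hv⟩), rfl⟩
  · obtain ⟨b, hb⟩ := hcentre v hv
    exact ⟨.old b, hb⟩
  · obtain ⟨b, hb, i, hi⟩ := hinner v hv
    exact ⟨_, hi⟩
  · obtain ⟨b, hb, i, hi⟩ := hinner _ (h.parent_outer hv).1
    refine ⟨.far b hb i, ?_⟩
    rw [← (h.parent_outer hv).2, ← hi]
    rfl
  · obtain ⟨x, -, hx⟩ := hclaw v hv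
    exact ⟨.old (.attached x), hx⟩
  · obtain ⟨x, hx, hxc⟩ := hclaw _ (h.parent_tip hv).1
    exact ⟨.old (.tip x hx false), by rw [place, basePlace, hxc, (h.parent_tip hv).2]⟩

/-- The tree reconstructed from a role assignment. -/
noncomputable abbrev rebuilt (T : SimpleGraph V) (f : V → Role) (occ : V → ℕ → V) :
    SimpleGraph (AppendVertex (carriers f occ) (innerCount T f occ)) :=
  appendP2 (baseTree (T.comap Subtype.val) (clawed f occ)) (carriers f occ) (innerCount T f occ)

theorem adj_place_of_rel (h : IsRoleAssignment T f occ)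
    {a b : AppendVertex (carriers f occ) (innerCount T f occ)}
    (hab : AppendRel (baseTree (T.comap Subtype.val) (clawed f occ)) _ _ a b) :
    T.Adj (place T f occ a) (place T f occ b) := by
  cases hab with
  | old h1 => exact h.adj_basePlace h1
  | near v hv i => exact (role_place_near v hv i).1
  | far v hv i => exact (h.role_place_far v hv i).1

theorem exists_parent (h : IsRoleAssignment T f occ)
    {a : AppendVertex (carriers f occ) (innerCount T f occ)}
    (ha : f (place T f occ a) ≠ .base) :
    ∃ b, place T f occ b = occ (place T f occ a) 1 ∧ (rebuilt T f occ).Adj b a := by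
  rcases a with a | ⟨a, hm, i⟩ | ⟨a, hm, i⟩
  · obtain ⟨b, hb, hba⟩ := h.exists_base_parent ha
    exact ⟨.old b, hb, (SimpleGraph.fromRel_adj _ _ _).2
      ⟨fun he => hba.ne (AppendVertex.old.inj he), .inl (.old hba)⟩⟩
  · exact ⟨.old a, (h.parent_place_near a hm i).symm,
      (SimpleGraph.fromRel_adj _ _ _).2 ⟨by simp, .inl (.near a hm i)⟩⟩
  · exact ⟨.near a hm i, (h.role_place_far a hm i).2.2.symm,
      (SimpleGraph.fromRel_adj _ _ _).2 ⟨by simp, .inl (.far a hm i)⟩⟩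

theorem exists_under_of_role (h : IsRoleAssignment T f occ)
    {a : AppendVertex (carriers f occ) (innerCount T f occ)}
    (ha : f (place T f occ a) = .base) : ∃ x, a = .old (.under x) := by
  obtain ⟨v, hv⟩ : ∃ x : {x // f x = .base}, place T f occ (.old (.under x)) = place T f occ a :=
    ⟨⟨_, ha⟩, rfl⟩
  exact ⟨v, (h.place_injective hv).symm⟩

/-- By `edge_cases` only edges between base vertices and edges to a parent need lifting. The rebuilt
tree joins each non-base vertex to a preimage of its parent, and injectivity identifies that
preimage. -/
theorem adj_place_iff (h : IsRoleAssignment T f occ)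
    {a b : AppendVertex (carriers f occ) (innerCount T f occ)} :
    T.Adj (place T f occ a) (place T f occ b) ↔ (rebuilt T f occ).Adj a b := by
  constructor
  · intro hab
    rcases h.edge_cases hab with ⟨ha, hb⟩ | ⟨ha, hp⟩ | ⟨hb, hp⟩
    · obtain ⟨x, rfl⟩ := h.exists_under_of_role ha
      obtain ⟨y, rfl⟩ := h.exists_under_of_role hb
      have hxy : (T.comap Subtype.val).Adj x y := hab
      refine (SimpleGraph.fromRel_adj _ _ _).2 ⟨fun he => hab.ne (congrArg _ he), .inl (.old ?_)⟩
      refine (SimpleGraph.fromRel_adj _ _ _).2 ⟨fun he => hab.ne ?_, .inl (.under hxy)⟩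
      rw [he]
    · obtain ⟨c, hc, hca⟩ := h.exists_parent ha
      rw [h.place_injective (hc.trans hp)] at hca
      exact hca.symm
    · obtain ⟨c, hc, hcb⟩ := h.exists_parent hb
      rwa [h.place_injective (hc.trans hp)] at hcb
  · intro hab
    rcases ((SimpleGraph.fromRel_adj _ _ _).1 hab).2 with h1 | h1
    · exact h.adj_place_of_rel h1
    · exact (h.adj_place_of_rel h1).symm

/-- A tree with a role assignment is isomorphic to the tree reconstructed from it. -/
noncomputable def rebuiltIso (h : IsRoleAssignment T f occ) : rebuilt T f occ ≃g T where
  toEquiv := Equiv.ofBijective (place T f occ) ⟨h.place_injective, h.place_surjective⟩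
  map_rel_iff' := h.adj_place_iff

end Place

end IsRoleAssignment

/-! ### Connectedness of the underlying tree -/

section Retraction

variable {V₀ : Type u} {T₀ : SimpleGraph V₀} {S : Set V₀}

/-- The vertex of the underlying tree below a vertex of the base tree. -/
def baseRetract : BaseVertex S → V₀
  | .under x => x
  | .attached x => x
  | .tip x _ _ => x

/-- The vertex of the underlying tree below a vertex of the final tree. -/
def retract {L : Set (BaseVertex S)} {k : BaseVertex S → ℕ} : AppendVertex L k → V₀
  | .old b => baseRetract b
  | .near b _ _ => baseRetract b
  | .far b _ _ => baseRetract b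

theorem reachable_baseRetract {a b : BaseVertex S} (hab : (baseTree T₀ S).Adj a b) :
    T₀.Reachable (baseRetract a) (baseRetract b) := by
  have key : ∀ {a b}, BaseRel T₀ S a b → T₀.Reachable (baseRetract a) (baseRetract b) := by
    intro a b h
    cases h with
    | under h => exact h.reachable
    | attached x => exact .refl _
    | tip x hx b => exact .refl _
  exact ((SimpleGraph.fromRel_adj _ _ _).1 hab).2.elim key fun h => (key h).symm

theorem reachable_retract {L : Set (BaseVertex S)} {k : BaseVertex S → ℕ} {a b : AppendVertex L k}
    (hab : (appendP2 (baseTree T₀ S) L k).Adj a b) : T₀.Reachable (retract a) (retract b) := by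
  have key : ∀ {a b}, AppendRel (baseTree T₀ S) L k a b →
      T₀.Reachable (retract a) (retract b) := by
    intro a b h
    cases h with
    | old h => exact reachable_baseRetract h
    | near v hv i => exact .refl _
    | far v hv i => exact .refl _
  exact ((SimpleGraph.fromRel_adj _ _ _).1 hab).2.elim key fun h => (key h).symm

/-- Collapsing every attachment onto the vertex of `T₀` below it sends each edge to an edge or a
single vertex, so walks project to `T₀`. -/
theorem connected_of_connected_appendP2 {L : Set (BaseVertex S)} {k : BaseVertex S → ℕ}
    (h : (appendP2 (baseTree T₀ S) L k).Connected) : T₀.Connected := by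
  have key : ∀ {a b} (w : (appendP2 (baseTree T₀ S) L k).Walk a b),
      T₀.Reachable (retract a) (retract b) := by
    intro a b w
    induction w with
    | nil => exact .refl _
    | cons h _ ih => exact (reachable_retract h).trans ih
  obtain ⟨a⟩ := h.nonempty
  have : Nonempty V₀ := ⟨retract a⟩
  refine ⟨fun x y => ?_⟩
  obtain ⟨w⟩ := h.preconnected (.old (.under x)) (.old (.under y))
  exact key w

end Retraction

theorem inFamily_of_isRoleAssignment [Finite V] (hT : T.IsTree)
    (h : IsRoleAssignment T f occ) : InFamily T := by
  refine ⟨{x // f x = .base}, inferInstance, T.comap Subtype.val, clawed f occ, carriers f occ,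
    innerCount T f occ, ⟨?_, ?_⟩, fun v hv => h.isLeaf_of_mem_carriers hv,
    h.isTwoPacking_carriers, ⟨h.rebuiltIso.symm⟩⟩
  · exact connected_of_connected_appendP2 (h.rebuiltIso.connected_iff.2 hT.connected)
  -- Acyclicity, unlike connectedness, passes directly to the subgraph induced by the base vertices.
  · exact hT.isAcyclic.of_comap (Function.Embedding.subtype _)

end Assembly

end NTD

theorem mainTheorem1 {V : Type u} [Fintype V] (T : SimpleGraph V) (hT : T.IsTree)
    (hn : 4 ≤ Fintype.card V)
    (hγ : (NTD.ntdNumber T : ℚ) = (Fintype.card V : ℚ) / 2) :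
    NTD.InFamily T := by
  have h2 : 2 * NTD.ntdNumber T = Fintype.card V := by
    have : (2 * NTD.ntdNumber T : ℚ) = Fintype.card V := by rw [hγ]; ring
    exact_mod_cast this
  obtain ⟨f, hf⟩ := NTD.exists_roles_of_two_mul_ntdNumber hT h2
  obtain ⟨occ, hocc⟩ := NTD.exists_isRoleAssignment hf
  exact NTD.inFamily_of_isRoleAssignment hT hocc
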